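/- Let $n\ge 1$ and let $\rho$ be a density matrix (positive semidefinite, trace one) on $\mathbb C^n$ with eigenvalues $\lambda=(\lambda_1,\dots,\lambda_n)$, listed with multiplicity. For a vector $x\in\mathbb R^n$ with positive, pairwise distinct entries put $$F(x)=-\sum_{i=1}^n \frac{x_i^{\,n}}{\prod_{j\ne i}(x_i-x_j)}\,\ln x_i .$$ The subentropy of $\rho$ is $Q(\rho)=F(\lambda)$ if the $\lambda_i$ are positive and pairwise distinct, and otherwise $Q(\rho)=\lim_{x\to\lambda}F(x)$, the limit being taken over vectors $x$ with positive, pairwise distinct entries. Let $S(\rho)=-\operatorname{tr}(\rho\ln\rho)$ be the von Neumann entropy, with $0\ln 0=0$, and for positive semidefinite $\sigma,\tau$ let the quantum relative entropy be $D(\sigma\|\tau)=\operatorname{tr}(\sigma\ln\sigma-\sigma\ln\tau)$ if $\operatorname{supp}\sigma\subseteq\operatorname{supp}\tau$, and $D(\sigma\|\tau)=\infty$ otherwise. For a unitary $U\in U(n)$ with columns $e_1,\dots,e_n$ let $\mathcal M_U(\sigma)=\sum_{i=1}^n\langle e_i|\sigma|e_i\rangle\,|e_i\rangle\langle e_i|$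 be the post-measurement state of the complete von Neumann measurement in the orthonormal basis $(e_i)$, and let $\langle f(\mathcal M)\rangle_{\mathcal M}=\int_{U(n)} f(\mathcal M_U)\,dU$ be the average with respect to the normalised Haar measure. Then: 1. The limit $\lim_{x\to\lambda}F(x)$ over vectors with positive, pairwise distinct entries exists, is finite, and equals $Q(\rho)$. 2. For every finite convex decomposition $\rho=\sum_j p_jP_j$ into pure states, i.e. $p_j\ge 0$, $\sum_j p_j=1$, $P_j=|\phi_j\rangle\langle\phi_j|$ with unit vectors $\phi_j\in\mathbb C^n$, $$Q(\rho)=\sum_j p_j\,\big\langle D(\mathcal M(P_j)\,\|\,\mathcal M(\rho))\big\rangle_{\mathcal M}$$ (an identity of extended real numbers, with $0\cdot\infty=0$; in particular the right-hand side is finite). 3. $Q(\rho)\le S(\rho)$. -/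

import Mathlib

open Matrix MeasureTheory Filter
open scoped Topology ENNReal ComplexOrder

noncomputable section

namespace Subentropy

/-- A state (density matrix) of a quantum system with Hilbert space `ℂⁿ`. -/
structure State (n : ℕ) where
  mat : Matrix (Fin n) (Fin n) ℂ
  posSemidef : mat.PosSemidef
  trace_eq_one : mat.trace = 1

/-- The eigenvalues of a state, listed with multiplicity. -/
def State.eigenvalues {n : ℕ} (ρ : State n) : Fin n → ℝ :=
  ρ.posSemidef.isHermitian.eigenvalues

/-- The expression `- ∑ i, (x i)ⁿ / ∏_{j ≠ i} (x i - x j) * ln (x i)`. -/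
def genericF {n : ℕ} (x : Fin n → ℝ) : ℝ :=
  -∑ i, x i ^ n / (∏ j ∈ Finset.univ.erase i, (x i - x j)) * Real.log (x i)

/-- The vectors at which the expression `genericF` is literally meaningful:
positive, pairwise distinct entries. -/
def genericVectors (n : ℕ) : Set (Fin n → ℝ) :=
  {x | Function.Injective x ∧ ∀ i, 0 < x i}

open Classical in
/-- The function `F`: the expression `genericF` at generic vectors, and elsewhere (coinciding or
vanishing entries) the limit of that expression along generic vectors. -/
def F {n : ℕ} (x : Fin n → ℝ) : ℝ :=
  if x ∈ genericVectors n then genericF x else limUnder (𝓝[genericVectors n] x) genericF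

/-- The subentropy `Q(ρ)`. -/
def subentropy {n : ℕ} (ρ : State n) : ℝ := F ρ.eigenvalues

/-- The von Neumann entropy `S(ρ) = - tr (ρ ln ρ)`; the logarithm of a Hermitian matrix is taken by
functional calculus, with value `0` on the kernel, so that `0 ln 0 = 0`. -/
def vonNeumannEntropy {n : ℕ} (ρ : State n) : ℝ :=
  -(ρ.mat * cfc Real.log ρ.mat).trace.re

open Classical in
/-- The quantum relative entropy `D(A ‖ B)` of two positive semidefinite matrices: it is
`tr (A ln A - A ln B)` if `supp A ⊆ supp B`, and `∞` otherwise. The support of a Hermitian matrix,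
i.e. the orthogonal complement of its kernel, is its range. -/
def relEntropy {n : ℕ} (A B : Matrix (Fin n) (Fin n) ℂ) : EReal :=
  if LinearMap.range A.mulVecLin ≤ LinearMap.range B.mulVecLin then
    (((A * cfc Real.log A - A * cfc Real.log B).trace.re : ℝ) : EReal)
  else ⊤

/-- The matrix of the operator `|v⟩⟨v|`. -/
def ketbra {n : ℕ} (v : Fin n → ℂ) : Matrix (Fin n) (Fin n) ℂ := vecMulVec v (star v)

/-- The post-measurement state `∑ i, ⟨e_i|A|e_i⟩ |e_i⟩⟨e_i|` of the complete von Neumann measurement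
in the orthonormal basis `e_1, …, e_n` formed by the columns of the unitary matrix `U`. -/
def measure {n : ℕ} (U : unitaryGroup (Fin n) ℂ) (A : Matrix (Fin n) (Fin n) ℂ) :
    Matrix (Fin n) (Fin n) ℂ :=
  ∑ i, (star (U.1.col i) ⬝ᵥ (A *ᵥ U.1.col i)) • ketbra (U.1.col i)

instance unitaryMeasurableSpace (n : ℕ) : MeasurableSpace (unitaryGroup (Fin n) ℂ) := borel _

instance unitaryBorelSpace (n : ℕ) : BorelSpace (unitaryGroup (Fin n) ℂ) := ⟨rfl⟩

instance unitaryCompactSpace (n : ℕ) : CompactSpace (unitaryGroup (Fin n) ℂ) := by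
  refine isCompact_iff_compactSpace.mp ?_
  have hK : IsCompact (Set.univ.pi fun _ : Fin n => Set.univ.pi fun _ : Fin n =>
      Metric.closedBall (0 : ℂ) 1) :=
    isCompact_univ_pi fun _ => isCompact_univ_pi fun _ => isCompact_closedBall _ _
  refine IsCompact.of_isClosed_subset (X := Matrix (Fin n) (Fin n) ℂ) hK ?_ ?_
  · have : ((unitaryGroup (Fin n) ℂ : Submonoid (Matrix (Fin n) (Fin n) ℂ)) :
        Set (Matrix (Fin n) (Fin n) ℂ)) = {A | star A * A = 1} := by
      ext A
      exact mem_unitaryGroup_iff'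
    rw [this]
    exact isClosed_eq (by fun_prop) continuous_const
  · intro A hA i _ j _
    simpa using entry_norm_bound_of_unitary hA i j

/-- The Haar measure on the unitary group `U(n)`, normalised to total mass one. -/
def haarUnitary (n : ℕ) : Measure (unitaryGroup (Fin n) ℂ) := Measure.haarMeasure ⊤

instance (n : ℕ) : IsProbabilityMeasure (haarUnitary n) :=
  ⟨by simpa [haarUnitary] using
    Measure.haarMeasure_self (K₀ := (⊤ : TopologicalSpace.PositiveCompacts
      (unitaryGroup (Fin n) ℂ)))⟩

/-- The Haar average of an extended-real function of the measurement basis: the Lebesgue integral of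
its positive part minus that of its negative part. -/
def haarAverage {n : ℕ} (f : unitaryGroup (Fin n) ℂ → EReal) : EReal :=
  ((∫⁻ U, (f U).toENNReal ∂(haarUnitary n) : ℝ≥0∞) : EReal) -
    ((∫⁻ U, (-f U).toENNReal ∂(haarUnitary n) : ℝ≥0∞) : EReal)

end Subentropy

end

namespace Subentropy

variable {n : ℕ}

/-! Everything is read off from a standard complex Gaussian vector `z` in `ℂⁿ`. Let `M(x)` be the
mean of `t ln t` at `t = ∑ i, x i * ‖z i‖²` (`meanMulLog`), and let `γ` be that mean for a single
`‖z i‖²` (`gaussMulLog`).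

For distinct positive `x i`, the characteristic function `∏ (1 - i t x_i)⁻¹` of the weighted sum
splits into partial fractions with coefficients `x_i ^ (n-1) / ∏ (x_i - x_j)`. Its law is therefore
a signed combination of the exponential laws of `x_i ‖z_i‖²`, and integrating `t ln t` gives `F(x) =
γ ∑ x_i - M(x)` (`meanMulLog_eq`). The right side is continuous on all of `ℝⁿ`, which gives the
limit. The entropy bound is superadditivity of `t ln t` on `t ≥ 0`, applied under the integral.

For the measurement identity, unitary invariance turns `M(λ)` into the Gaussian mean of `q ln q`, `q
= ⟨z|ρ|z⟩`. Separating norm from direction expresses the Haar mean of `⟨e_i|ρ|e_i⟩ ln ⟨e_i|ρ|e_i⟩`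
as `(M(λ) - c)/n`, with `c` the same for all unit-trace matrices; for a pure state `M` is `γ`. In
the averaged relative entropy `c` cancels and the `n` outcomes contribute `γ - M(λ) = Q(ρ)` in
total. -/

/-! ### The Gaussian measure and its moments. -/

/-- The density of the standard complex Gaussian distribution on `ℂ`. -/
noncomputable def gaussDensity (w : ℂ) : ℝ := Real.pi⁻¹ * Real.exp (-‖w‖ ^ 2)

lemma continuous_gaussDensity : Continuous gaussDensity := by
  unfold gaussDensity; fun_prop

lemma gaussDensity_pos (w : ℂ) : 0 < gaussDensity w := by
  unfold gaussDensity; positivity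

/-- The standard complex Gaussian distribution on `ℂⁿ`. -/
noncomputable def gauss (n : ℕ) : Measure (Fin n → ℂ) :=
  volume.withDensity fun z => ENNReal.ofReal (∏ i, gaussDensity (z i))

lemma continuous_prod_gaussDensity :
    Continuous fun z : Fin n → ℂ => ∏ i, gaussDensity (z i) :=
  continuous_finsetProd _ fun i _ => continuous_gaussDensity.comp (continuous_apply i)

lemma prod_gaussDensity_pos (z : Fin n → ℂ) : 0 < ∏ i, gaussDensity (z i) :=
  Finset.prod_pos fun i _ => gaussDensity_pos (z i)

lemma prod_gaussDensity (z : Fin n → ℂ) :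
    ∏ i, gaussDensity (z i) = Real.pi⁻¹ ^ n * Real.exp (-∑ i, ‖z i‖ ^ 2) := by
  simp [gaussDensity, Finset.prod_mul_distrib, ← Real.exp_sum]

lemma integral_gauss {E : Type*} [NormedAddCommGroup E] [NormedSpace ℝ E]
    (f : (Fin n → ℂ) → E) :
    ∫ z, f z ∂(gauss n) = ∫ z, (∏ i, gaussDensity (z i)) • f z := by
  rw [gauss, integral_withDensity_eq_integral_toReal_smul]
  · simp only [ENNReal.toReal_ofReal (prod_gaussDensity_pos _).le]
  · exact continuous_prod_gaussDensity.measurable.ennreal_ofReal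
  · simp

lemma integrable_gauss_iff {E : Type*} [NormedAddCommGroup E] [NormedSpace ℝ E]
    {f : (Fin n → ℂ) → E} :
    Integrable f (gauss n) ↔ Integrable fun z => (∏ i, gaussDensity (z i)) • f z := by
  rw [gauss, integrable_withDensity_iff_integrable_smul']
  · simp only [ENNReal.toReal_ofReal (prod_gaussDensity_pos _).le]
  · exact continuous_prod_gaussDensity.measurable.ennreal_ofReal
  · simp

lemma integral_gauss_prod {𝕜 : Type*} [RCLike 𝕜] (f : Fin n → ℂ → 𝕜) :
    ∫ z, ∏ i, f i (z i) ∂(gauss n) = ∏ i, ∫ w, (gaussDensity w : 𝕜) * f i w := by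
  rw [integral_gauss, ← integral_fintype_prod_volume_eq_prod]
  simp [Finset.prod_mul_distrib, RCLike.real_smul_eq_coe_mul]

lemma integrable_gauss_prod {𝕜 : Type*} [RCLike 𝕜] {f : Fin n → ℂ → 𝕜}
    (hf : ∀ i, Integrable fun w => (gaussDensity w : 𝕜) * f i w) :
    Integrable (fun z => ∏ i, f i (z i)) (gauss n) := by
  rw [integrable_gauss_iff]
  refine (Integrable.fintype_prod hf).congr (.of_forall fun z => ?_)
  simp [Finset.prod_mul_distrib, RCLike.real_smul_eq_coe_mul]

/-- The squared modulus is exponentially distributed with mean one; this is its moment generating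
function, needed at imaginary `b`. -/
lemma integral_gaussDensity_mul_cexp (b : ℂ) (hb : b.re < 1) :
    ∫ w : ℂ, (gaussDensity w : ℂ) * Complex.exp (b * (‖w‖ ^ 2 : ℝ)) = (1 - b)⁻¹ := by
  have h := GaussianFourier.integral_cexp_neg_mul_sq_norm (V := ℂ) (b := 1 - b) (by simpa using hb)
  have hpi : (Real.pi : ℂ) ≠ 0 := by exact_mod_cast Real.pi_ne_zero
  have e : ∀ w : ℂ, (gaussDensity w : ℂ) * Complex.exp (b * (‖w‖ ^ 2 : ℝ)) =
      (Real.pi : ℂ)⁻¹ * Complex.exp (-(1 - b) * (‖w‖ : ℂ) ^ 2) := by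
    intro w
    simp only [gaussDensity, Complex.ofReal_mul, Complex.ofReal_exp, mul_assoc, ← Complex.exp_add,
      Complex.ofReal_inv]
    congr 2
    push_cast
    ring
  simp_rw [e, integral_const_mul, h]
  simp
  field_simp

lemma integral_gaussDensity_mul_pow (k : ℕ) :
    ∫ w : ℂ, gaussDensity w * (‖w‖ ^ (2 * k)) = k.factorial := by
  have h := Complex.integral_rpow_mul_exp_neg_rpow (p := 2) (q := (2 * k : ℕ)) (by norm_num)
    (by push_cast; linarith [Nat.cast_nonneg (α := ℝ) k])
  have e : ∀ w : ℂ, gaussDensity w * (‖w‖ ^ (2 * k)) =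
      Real.pi⁻¹ * (‖w‖ ^ ((2 * k : ℕ) : ℝ) * Real.exp (-‖w‖ ^ (2 : ℝ))) := by
    intro w
    rw [Real.rpow_natCast, gaussDensity, Real.rpow_two]
    ring
  simp_rw [e, integral_const_mul, h]
  have : (((2 * k : ℕ) : ℝ) + 2) / 2 = (k : ℝ) + 1 := by push_cast; ring
  rw [this, Real.Gamma_nat_eq_factorial]
  field_simp

lemma integrable_gaussDensity_mul_pow (k : ℕ) :
    Integrable fun w : ℂ => gaussDensity w * (‖w‖ ^ (2 * k)) := by
  -- A non-integrable function has integral `0` by convention, so a nonzero value proves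
  -- integrability.
  apply Integrable.of_integral_ne_zero
  rw [integral_gaussDensity_mul_pow]
  positivity

lemma integral_gaussDensity : ∫ w : ℂ, gaussDensity w = 1 := by
  simpa using integral_gaussDensity_mul_pow 0

lemma integrable_gaussDensity : Integrable gaussDensity := by
  simpa using integrable_gaussDensity_mul_pow 0

instance : IsProbabilityMeasure (gauss n) := by
  have h1 := integral_gauss_prod (n := n) (𝕜 := ℝ) fun _ _ => 1
  have h2 := integrable_gauss_prod (n := n) (𝕜 := ℝ) (f := fun _ _ => 1)
    fun _ => by simpa using integrable_gaussDensity
  simp [integral_gaussDensity] at h1 h2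
  have := h2.1
  constructor
  rw [measureReal_def, ENNReal.toReal_eq_one_iff] at h1
  exact h1

lemma prod_ite_eq_pow (z : Fin n → ℂ) (i : Fin n) (k : ℕ) :
    ∏ j, (if j = i then ‖z j‖ ^ (2 * k) else 1) = ‖z i‖ ^ (2 * k) := by
  simp

lemma integrable_norm_pow (i : Fin n) (k : ℕ) :
    Integrable (fun z : Fin n → ℂ => ‖z i‖ ^ (2 * k)) (gauss n) := by
  have := integrable_gauss_prod (n := n) (𝕜 := ℝ)
    (f := fun j w => if j = i then ‖w‖ ^ (2 * k) else 1) fun j => by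
      by_cases h : j = i
      · simpa [h] using integrable_gaussDensity_mul_pow k
      · simpa [h] using integrable_gaussDensity
  simpa using this

lemma integral_norm_sq (i : Fin n) : ∫ z : Fin n → ℂ, ‖z i‖ ^ 2 ∂(gauss n) = 1 := by
  have := integral_gauss_prod (n := n) (𝕜 := ℝ) fun j w => if j = i then ‖w‖ ^ (2 * 1) else 1
  simp only [prod_ite_eq_pow] at this
  rw [mul_one] at this
  rw [this]
  refine Finset.prod_eq_one fun j _ => ?_
  by_cases h : j = i
  · simpa [h] using integral_gaussDensity_mul_pow 1
  · simpa [h] using integral_gaussDensity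

/-! ### Characteristic functions and partial fractions. -/

/-- The weighted square norm `∑ i, x i * ‖z i‖²`. -/
noncomputable def weightedSq (x : Fin n → ℝ) (z : Fin n → ℂ) : ℝ := ∑ i, x i * ‖z i‖ ^ 2

lemma continuous_weightedSq (x : Fin n → ℝ) : Continuous (weightedSq x) := by
  unfold weightedSq; fun_prop

lemma weightedSq_single (i : Fin n) (a : ℝ) (z : Fin n → ℂ) :
    weightedSq (Pi.single i a) z = a * ‖z i‖ ^ 2 := by
  simp [weightedSq, Pi.single_apply]

lemma integral_cexp_weightedSq (x : Fin n → ℝ) (t : ℝ) :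
    ∫ z, Complex.exp (t * weightedSq x z * Complex.I) ∂(gauss n) =
      ∏ i, (1 - t * x i * Complex.I)⁻¹ := by
  have h : ∀ i, ∫ w : ℂ, (gaussDensity w : ℂ) *
      Complex.exp ((t * x i * Complex.I) * (‖w‖ ^ 2 : ℝ)) = (1 - t * x i * Complex.I)⁻¹ :=
    fun i => integral_gaussDensity_mul_cexp _ (by simp)
  have h' := integral_gauss_prod (𝕜 := ℂ)
    fun (i : Fin n) w => Complex.exp ((t * x i * Complex.I) * (‖w‖ ^ 2 : ℝ))
  refine Eq.trans ?_ (h'.trans (Finset.prod_congr rfl fun i _ => h i))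
  congr 1 with z
  rw [← Complex.exp_sum]
  congr 1
  simp only [weightedSq]
  push_cast
  rw [Finset.mul_sum, Finset.sum_mul]
  exact Finset.sum_congr rfl fun i _ => by ring

lemma charFun_map_weightedSq (x : Fin n → ℝ) (t : ℝ) :
    charFun ((gauss n).map (weightedSq x)) t = ∏ i, (1 - t * x i * Complex.I)⁻¹ := by
  rw [charFun_apply_real, integral_map (continuous_weightedSq x).aemeasurable
    (by fun_prop)]
  exact integral_cexp_weightedSq x t

/-- Both sides are polynomials in `s` of degree below `n` that agree at the `n` points `(y k)⁻¹`:
there only the `k`-th summand survives, and its power `y k ^ (n - 1)` turns `∏ (1 - y j / y k)` into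
the denominator. -/
lemma sum_div_prod_sub_mul_prod_one_sub {K : Type*} [Field K] (hn : 0 < n)
    (y : Fin n → K) (hy : Function.Injective y) (hy0 : ∀ i, y i ≠ 0) (s : K) :
    ∑ i, y i ^ (n - 1) / (∏ j ∈ Finset.univ.erase i, (y i - y j)) *
      ∏ j ∈ Finset.univ.erase i, (1 - s * y j) = 1 := by
  classical
  open Polynomial in
  let p : K[X] := ∑ i, C (y i ^ (n - 1) / (∏ j ∈ Finset.univ.erase i, (y i - y j))) *
      ∏ j ∈ Finset.univ.erase i, (1 - X * C (y j))
  have hd : p.degree < Fintype.card (Fin n) := by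
    refine (Polynomial.degree_sum_le _ _).trans_lt ?_
    rw [Finset.sup_lt_iff (by exact WithBot.bot_lt_coe _)]
    intro i _
    refine (Polynomial.degree_mul_le _ _).trans_lt ?_
    refine (add_le_add Polynomial.degree_C_le (Polynomial.degree_prod_le _ _)).trans_lt ?_
    have h1 : ∀ j, (1 - Polynomial.X * Polynomial.C (y j) : Polynomial K).degree ≤ (1 : ℕ) := by
      intro j
      refine (Polynomial.degree_sub_le _ _).trans (max_le ?_ ?_)
      · exact Polynomial.degree_one_le.trans (by norm_num)
      · rw [mul_comm]
        exact Polynomial.degree_C_mul_X_le _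
    refine (add_le_add le_rfl (Finset.sum_le_sum fun j _ => h1 j)).trans_lt ?_
    simp only [Finset.sum_const, zero_add, Finset.card_erase_of_mem (Finset.mem_univ i),
      Finset.card_univ, Fintype.card_fin, nsmul_eq_mul]
    norm_cast
    omega
  have hp : p = 1 := by
    have hcard : (Finset.univ.image fun i => (y i)⁻¹).card = Fintype.card (Fin n) := by
      rw [Finset.card_image_of_injective _ fun i j e => hy (inv_injective e), Finset.card_univ]
    refine Polynomial.eq_of_degrees_lt_of_eval_finset_eq (Finset.univ.image fun i => (y i)⁻¹)
      (by rwa [hcard]) ?_ ?_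
    · rw [hcard, Polynomial.degree_one, Fintype.card_fin]
      exact_mod_cast hn
    · intro w hw
      obtain ⟨k, -, rfl⟩ := Finset.mem_image.1 hw
      simp only [p, Polynomial.eval_finsetSum, Polynomial.eval_mul, Polynomial.eval_C,
        Polynomial.eval_prod, Polynomial.eval_sub, Polynomial.eval_one, Polynomial.eval_X]
      rw [Finset.sum_eq_single k]
      · have h2 : ∏ j ∈ Finset.univ.erase k, (y k - y j) =
            y k ^ (n - 1) * ∏ j ∈ Finset.univ.erase k, (1 - (y k)⁻¹ * y j) := by
          have : y k ^ (n - 1) = ∏ _j ∈ Finset.univ.erase k, y k := by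
            simp [Finset.card_erase_of_mem]
          rw [this, ← Finset.prod_mul_distrib]
          refine Finset.prod_congr rfl fun j _ => ?_
          have := hy0 k
          field_simp
        have h3 : ∏ j ∈ Finset.univ.erase k, (y k - y j) ≠ 0 :=
          Finset.prod_ne_zero_iff.2 fun j hj =>
            sub_ne_zero.2 fun e => (Finset.ne_of_mem_erase hj) (hy e).symm
        rw [div_mul_eq_mul_div, ← h2, div_self h3]
      · intro i _ hik
        refine mul_eq_zero_of_right _
          (Finset.prod_eq_zero (Finset.mem_erase.2 ⟨hik.symm, Finset.mem_univ k⟩) ?_)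
        rw [inv_mul_cancel₀ (hy0 k), sub_self]
      · simp
  have := congrArg (Polynomial.eval s) hp
  simpa only [p, Polynomial.eval_finsetSum, Polynomial.eval_prod, Polynomial.eval_mul,
    Polynomial.eval_C, Polynomial.eval_sub, Polynomial.eval_one, Polynomial.eval_X] using this

/-- The `c i` may be negative, so the negative parts are moved to the side of `μ`; both sides are
then finite positive measures, which their characteristic functions determine. -/
lemma integral_eq_sum_of_charFun_eq {ι : Type*} [Fintype ι] {μ : Measure ℝ} [IsFiniteMeasure μ]
    {ν : ι → Measure ℝ} [∀ i, IsFiniteMeasure (ν i)] {c : ι → ℝ}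
    (h : ∀ t, charFun μ t = ∑ i, c i * charFun (ν i) t) {k : ℝ → ℝ} (hk : Integrable k μ)
    (hk' : ∀ i, Integrable k (ν i)) : ∫ x, k x ∂μ = ∑ i, c i * ∫ x, k x ∂(ν i) := by
  have key : ∀ {E : Type} [NormedAddCommGroup E] [NormedSpace ℝ E] (f : ℝ → E),
      Integrable f μ → (∀ i, Integrable f (ν i)) →
      (∫ x, f x ∂(μ + ∑ i, (-c i).toNNReal • ν i) = ∫ x, f x ∂μ +
        ∑ i, (-c i).toNNReal • ∫ x, f x ∂(ν i)) ∧
      (∫ x, f x ∂(∑ i, (c i).toNNReal • ν i) = ∑ i, (c i).toNNReal • ∫ x, f x ∂(ν i)) := by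
    intro E _ _ f hf hf'
    have hi : ∀ a : NNReal, ∀ i, Integrable f (a • ν i) := fun a i =>
      (hf' i).smul_measure (by simp)
    constructor
    · rw [integral_add_measure hf (integrable_finsetSum_measure.2 fun i _ => hi _ i),
        integral_finsetSum_measure fun i _ => hi _ i]
      simp only [integral_smul_nnreal_measure]
    · rw [integral_finsetSum_measure fun i _ => hi _ i]
      simp only [integral_smul_nnreal_measure]
  have split : ∀ a : ℝ, ((a.toNNReal : ℝ)) = a + (-a).toNNReal := fun a => by
    rw [Real.coe_toNNReal', Real.coe_toNNReal']
    rcases le_total 0 a with h | h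
    · rw [max_eq_left h, max_eq_right (by linarith)]; ring
    · rw [max_eq_right h, max_eq_left (by linarith)]; ring
  have hμ : μ + ∑ i, (-c i).toNNReal • ν i = ∑ i, (c i).toNNReal • ν i := by
    refine Measure.ext_of_charFun (funext fun t => ?_)
    have hb : ∀ (ρ : Measure ℝ) [IsFiniteMeasure ρ],
        Integrable (fun x : ℝ => Complex.exp (t * x * Complex.I)) ρ := by
      intro ρ _
      refine Integrable.of_bound (by fun_prop) 1 (.of_forall fun x => ?_)
      rw [← Complex.ofReal_mul, Complex.norm_exp_ofReal_mul_I]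
    obtain ⟨h1, h2⟩ := key _ (hb μ) fun i => hb (ν i)
    have ht := h t
    simp only [charFun_apply_real] at ht ⊢
    rw [h1, h2, ht, ← Finset.sum_add_distrib]
    refine Finset.sum_congr rfl fun i _ => ?_
    simp only [NNReal.smul_def, Complex.real_smul]
    rw [split (c i)]
    push_cast
    ring
  obtain ⟨h1, h2⟩ := key _ hk hk'
  rw [hμ, h2] at h1
  have : ∫ x, k x ∂μ = ∑ i, (c i).toNNReal • ∫ x, k x ∂(ν i) -
      ∑ i, (-c i).toNNReal • ∫ x, k x ∂(ν i) := by rw [h1]; ring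
  rw [this, ← Finset.sum_sub_distrib]
  refine Finset.sum_congr rfl fun i _ => ?_
  simp only [NNReal.smul_def, smul_eq_mul]
  rw [split (c i)]
  ring

/-! ### Quadratic growth and integrability. -/

/-- This growth bound reduces integrability of `t ln t` of a quadratic form to the second moment of
`∑ i, ‖z i‖²`. -/
lemma abs_mul_log_le (t : ℝ) : |t * Real.log t| ≤ 1 + t ^ 2 := by
  rw [← Real.log_abs, abs_mul, ← sq_abs t]
  rcases eq_or_ne t 0 with rfl | h0
  · simp
  have hp : 0 < |t| := abs_pos.2 h0
  rcases le_total |t| 1 with h | h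
  · have := Real.abs_log_mul_self_lt |t| hp h
    rw [abs_mul, abs_abs] at this
    nlinarith [sq_nonneg |t|]
  · rw [abs_of_nonneg (Real.log_nonneg h)]
    nlinarith [Real.log_le_sub_one_of_pos hp]

lemma integrable_sq_sum_norm_sq :
    Integrable (fun z : Fin n → ℂ => (∑ i, ‖z i‖ ^ 2) ^ 2) (gauss n) := by
  refine Integrable.mono' (g := fun z => (n : ℝ) * ∑ i, ‖z i‖ ^ (2 * 2)) ?_ ?_ ?_
  · exact (integrable_finsetSum _ fun i _ => integrable_norm_pow i 2).const_mul _
  · exact (by fun_prop : Continuous fun z : Fin n → ℂ => (∑ i, ‖z i‖ ^ 2) ^ 2).aestronglyMeasurable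
  · refine .of_forall fun z => ?_
    rw [Real.norm_of_nonneg (by positivity)]
    have := sq_sum_le_card_mul_sum_sq (s := Finset.univ) (f := fun i => ‖z i‖ ^ 2)
    simpa [← pow_mul] using this

lemma norm_comp_le_of_growth {k : ℝ → ℝ} (hk' : ∀ t, |k t| ≤ 1 + t ^ 2) {t C N : ℝ}
    (h : |t| ≤ C * N) : ‖k t‖ ≤ 1 + C ^ 2 * N ^ 2 := by
  rw [Real.norm_eq_abs]
  refine (hk' _).trans (add_le_add le_rfl ?_)
  rw [← mul_pow, ← sq_abs t]
  exact pow_le_pow_left₀ (abs_nonneg _) h 2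

lemma integrable_growth_bound (C : ℝ) :
    Integrable (fun z : Fin n → ℂ => 1 + C ^ 2 * (∑ i, ‖z i‖ ^ 2) ^ 2) (gauss n) :=
  (integrable_const _).add (integrable_sq_sum_norm_sq.const_mul _)

lemma integrable_comp_of_growth {k : ℝ → ℝ} (hk : Continuous k) (hk' : ∀ t, |k t| ≤ 1 + t ^ 2)
    {f : (Fin n → ℂ) → ℝ} (hf : Continuous f) {C : ℝ} (hC : ∀ z, |f z| ≤ C * ∑ i, ‖z i‖ ^ 2) :
    Integrable (fun z => k (f z)) (gauss n) :=
  (integrable_growth_bound C).mono' (hk.comp hf).aestronglyMeasurable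
    (.of_forall fun z => norm_comp_le_of_growth hk' (hC z))

lemma abs_weightedSq_le {x : Fin n → ℝ} {C : ℝ} (hx : ∀ i, |x i| ≤ C) (z : Fin n → ℂ) :
    |weightedSq x z| ≤ C * ∑ i, ‖z i‖ ^ 2 := by
  rw [weightedSq, Finset.mul_sum]
  refine (Finset.abs_sum_le_sum_abs _ _).trans (Finset.sum_le_sum fun i _ => ?_)
  rw [abs_mul, abs_of_nonneg (sq_nonneg ‖z i‖)]
  exact mul_le_mul_of_nonneg_right (hx i) (sq_nonneg _)

lemma integrable_comp_weightedSq {k : ℝ → ℝ} (hk : Continuous k)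
    (hk' : ∀ t, |k t| ≤ 1 + t ^ 2) (x : Fin n → ℝ) :
    Integrable (fun z => k (weightedSq x z)) (gauss n) :=
  integrable_comp_of_growth hk hk' (continuous_weightedSq x)
    (abs_weightedSq_le fun i => norm_le_pi_norm x i)

lemma abs_le_one_add_sq (t : ℝ) : |t| ≤ 1 + t ^ 2 := by
  rw [← sq_abs]
  nlinarith [sq_nonneg (|t| - 1), sq_nonneg |t|]

lemma integrable_mul_log_weightedSq (x : Fin n → ℝ) :
    Integrable (fun z => weightedSq x z * Real.log (weightedSq x z)) (gauss n) :=
  integrable_comp_weightedSq Real.continuous_mul_log abs_mul_log_le x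

lemma integrable_weightedSq (x : Fin n → ℝ) : Integrable (weightedSq x) (gauss n) :=
  integrable_comp_weightedSq continuous_id abs_le_one_add_sq x

/-! ### The closed form of the mean of `t ln t`. -/

/-- The mean of `t ln t` for `t` the squared modulus of a standard complex Gaussian variable. -/
noncomputable def gaussMulLog : ℝ :=
  ∫ w : ℂ, gaussDensity w * (‖w‖ ^ 2 * Real.log (‖w‖ ^ 2))

lemma integrable_mul_log_norm_sq (i : Fin n) :
    Integrable (fun z : Fin n → ℂ => ‖z i‖ ^ 2 * Real.log (‖z i‖ ^ 2)) (gauss n) := by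
  simpa [weightedSq_single] using integrable_mul_log_weightedSq (Pi.single i 1)

lemma integral_mul_log_norm_sq (i : Fin n) :
    ∫ z : Fin n → ℂ, ‖z i‖ ^ 2 * Real.log (‖z i‖ ^ 2) ∂(gauss n) = gaussMulLog := by
  have := integral_gauss_prod (n := n) (𝕜 := ℝ) fun j w =>
    if j = i then ‖w‖ ^ 2 * Real.log (‖w‖ ^ 2) else 1
  simp only [Finset.prod_ite_eq', Finset.mem_univ, if_true] at this
  rw [this, Finset.prod_eq_single i]
  · simp [gaussMulLog]
  · intro j _ hj
    simpa [hj] using integral_gaussDensity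
  · simp

lemma mul_log_mul (a b : ℝ) :
    a * b * Real.log (a * b) = a * Real.log a * b + a * (b * Real.log b) := by
  rcases eq_or_ne a 0 with rfl | ha
  · simp
  rcases eq_or_ne b 0 with rfl | hb
  · simp
  rw [Real.log_mul ha hb]
  ring

lemma integral_mul_log_mul_norm_sq (i : Fin n) (a : ℝ) :
    ∫ z : Fin n → ℂ, a * ‖z i‖ ^ 2 * Real.log (a * ‖z i‖ ^ 2) ∂(gauss n) =
      a * Real.log a + a * gaussMulLog := by
  simp_rw [mul_log_mul]
  have h2 : Integrable (fun z : Fin n → ℂ => ‖z i‖ ^ 2) (gauss n) := by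
    simpa using integrable_norm_pow i 1
  rw [integral_add (h2.const_mul _) ((integrable_mul_log_norm_sq i).const_mul _),
    integral_const_mul, integral_const_mul, integral_norm_sq, integral_mul_log_norm_sq, mul_one]

/-- The mean of `t ln t` for `t = ∑ i, x i * ‖z i‖²` with `z` standard complex Gaussian. -/
noncomputable def meanMulLog (x : Fin n → ℝ) : ℝ :=
  ∫ z, weightedSq x z * Real.log (weightedSq x z) ∂(gauss n)

lemma integral_weightedSq (x : Fin n → ℝ) : ∫ z, weightedSq x z ∂(gauss n) = ∑ i, x i := by
  unfold weightedSq
  have h2 : ∀ i, Integrable (fun z : Fin n → ℂ => ‖z i‖ ^ 2) (gauss n) := fun i => by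
    simpa using integrable_norm_pow i 1
  rw [integral_finsetSum _ fun i _ => (h2 i).const_mul _]
  simp_rw [integral_const_mul, integral_norm_sq, mul_one]

lemma prod_inv_eq_sum {x : Fin n → ℝ} (hn : 0 < n) (hx : x ∈ genericVectors n) (t : ℝ) :
    ∏ i, (1 - t * x i * Complex.I)⁻¹ =
      ∑ i, ((x i ^ (n - 1) / ∏ j ∈ Finset.univ.erase i, (x i - x j) : ℝ) : ℂ) *
        (1 - t * x i * Complex.I)⁻¹ := by
  have h := sum_div_prod_sub_mul_prod_one_sub hn (fun i => (x i : ℂ))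
    (Complex.ofReal_injective.comp hx.1) (fun i => Complex.ofReal_ne_zero.2 (hx.2 i).ne')
    (t * Complex.I)
  have hne : ∀ i, (1 - t * Complex.I * x i : ℂ) ≠ 0 := by
    intro i h0
    simpa using congrArg Complex.re h0
  have hr : ∀ i, (1 - t * x i * Complex.I : ℂ) = 1 - t * Complex.I * x i := fun i => by ring
  simp_rw [hr]
  rw [← one_mul (∏ i, (1 - t * Complex.I * x i : ℂ)⁻¹)]
  nth_rw 1 [← h]
  rw [Finset.sum_mul]
  refine Finset.sum_congr rfl fun i _ => ?_
  push_cast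
  rw [mul_assoc]
  congr 1
  rw [← Finset.mul_prod_erase _ _ (Finset.mem_univ i), mul_left_comm, ← Finset.prod_mul_distrib,
    Finset.prod_eq_one fun j _ => mul_inv_cancel₀ (hne j), mul_one]

lemma integral_comp_weightedSq_eq_sum {x : Fin n → ℝ} (hn : 0 < n) (hx : x ∈ genericVectors n)
    {k : ℝ → ℝ} (hk : Continuous k) (hk' : ∀ t, |k t| ≤ 1 + t ^ 2) :
    ∫ z, k (weightedSq x z) ∂(gauss n) =
      ∑ i, x i ^ (n - 1) / (∏ j ∈ Finset.univ.erase i, (x i - x j)) *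
        ∫ z, k (x i * ‖z i‖ ^ 2) ∂(gauss n) := by
  have hm : ∀ y : Fin n → ℝ, AEMeasurable (weightedSq y) (gauss n) :=
    fun y => (continuous_weightedSq y).aemeasurable
  have : ∀ y, IsProbabilityMeasure ((gauss n).map (weightedSq y)) :=
    fun y => Measure.isProbabilityMeasure_map (hm y)
  have hint : ∀ y, Integrable k ((gauss n).map (weightedSq y)) := fun y =>
    (integrable_map_measure hk.aestronglyMeasurable (hm y)).2 (integrable_comp_weightedSq hk hk' y)
  have key := integral_eq_sum_of_charFun_eq (μ := (gauss n).map (weightedSq x))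
    (ν := fun i => (gauss n).map (weightedSq (Pi.single i (x i))))
    (c := fun i => x i ^ (n - 1) / ∏ j ∈ Finset.univ.erase i, (x i - x j))
    (fun t => by
      simp_rw [charFun_map_weightedSq]
      rw [prod_inv_eq_sum hn hx]
      refine Finset.sum_congr rfl fun i _ => ?_
      congr 1
      rw [Finset.prod_eq_single i]
      · simp
      · intro j _ hj
        simp [hj]
      · simp) (hint x) fun i => hint _
  simp_rw [fun y => integral_map (hm y) (hk.aestronglyMeasurable)] at key
  simpa only [weightedSq_single] using key

lemma meanMulLog_eq {x : Fin n → ℝ} (hn : 0 < n) (hx : x ∈ genericVectors n) :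
    meanMulLog x = gaussMulLog * ∑ i, x i - genericF x := by
  have h1 := integral_comp_weightedSq_eq_sum hn hx Real.continuous_mul_log abs_mul_log_le
  -- Taking `k = id` shows that the partial-fraction coefficients satisfy `∑ c_i x_i = ∑ x_i`.
  have h2 := integral_comp_weightedSq_eq_sum hn hx continuous_id abs_le_one_add_sq
  simp only [id, integral_weightedSq, integral_const_mul, integral_norm_sq, mul_one] at h2
  rw [meanMulLog, h1, h2, genericF, sub_neg_eq_add, Finset.mul_sum, ← Finset.sum_add_distrib]
  refine Finset.sum_congr rfl fun i _ => ?_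
  rw [integral_mul_log_mul_norm_sq]
  obtain ⟨m, rfl⟩ : ∃ m, n = m + 1 := ⟨n - 1, by omega⟩
  rw [Nat.add_sub_cancel, pow_succ]
  ring

/-! ### Continuity and the limit along generic vectors. -/

lemma continuous_meanMulLog : Continuous (meanMulLog : (Fin n → ℝ) → ℝ) := by
  rw [continuous_iff_continuousAt]
  intro x₀
  refine continuousAt_of_dominated (bound := fun z => 1 + (‖x₀‖ + 1) ^ 2 * (∑ i, ‖z i‖ ^ 2) ^ 2)
    ?_ ?_ (integrable_growth_bound _) ?_
  · exact .of_forall fun x => (integrable_mul_log_weightedSq x).aestronglyMeasurable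
  · filter_upwards [Metric.ball_mem_nhds x₀ one_pos] with x hx
    refine .of_forall fun z => norm_comp_le_of_growth (k := fun t => t * Real.log t) abs_mul_log_le
      (abs_weightedSq_le (fun i => ?_) z)
    have h1 : ‖x - x₀‖ < 1 := by simpa [dist_eq_norm] using hx
    calc |x i| ≤ ‖x‖ := norm_le_pi_norm x i
      _ ≤ ‖x₀‖ + ‖x - x₀‖ := by simpa using norm_add_le x₀ (x - x₀)
      _ ≤ _ := by linarith
  · refine .of_forall fun z => Continuous.continuousAt ?_
    refine Real.continuous_mul_log.comp ?_
    unfold weightedSq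
    fun_prop

/-- The perturbation `x i + ε (i + 1)` is positive with distinct entries for all small `ε > 0`.
Without this, `limUnder` would not be determined by convergence. -/
lemma nhdsWithin_genericVectors_neBot {x : Fin n → ℝ} (hx : ∀ i, 0 ≤ x i) :
    (𝓝[genericVectors n] x).NeBot := by
  have ht : Tendsto (fun (ε : ℝ) (i : Fin n) => x i + ε * ((i : ℝ) + 1)) (𝓝[>] 0) (𝓝 x) := by
    have : Continuous fun (ε : ℝ) (i : Fin n) => x i + ε * ((i : ℝ) + 1) := by fun_prop
    simpa using (this.tendsto 0).mono_left nhdsWithin_le_nhds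
  have hg : ∀ᶠ ε : ℝ in 𝓝[>] 0, (fun i : Fin n => x i + ε * ((i : ℝ) + 1)) ∈ genericVectors n := by
    have hne : ∀ i j : Fin n, i ≠ j →
        ∀ᶠ ε : ℝ in 𝓝[>] 0, x i + ε * ((i : ℝ) + 1) ≠ x j + ε * ((j : ℝ) + 1) := by
      intro i j hij
      have hij' : ((j : ℝ) - i) ≠ 0 := sub_ne_zero.2 fun h => hij (Fin.ext (by exact_mod_cast h.symm))
      by_cases h : x i = x j
      · filter_upwards [self_mem_nhdsWithin] with ε hε e
        have hε' : ε ≠ 0 := ne_of_gt hε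
        rw [h] at e
        exact mul_ne_zero hε' hij' (by linarith)
      · have hi := (tendsto_pi_nhds.1 ht) i
        have hj := (tendsto_pi_nhds.1 ht) j
        exact ((hi.sub hj).eventually_ne (sub_ne_zero.2 h)).mono fun ε he => sub_ne_zero.1 he
    have hall : ∀ᶠ ε : ℝ in 𝓝[>] 0, ∀ i j : Fin n, i ≠ j →
        x i + ε * ((i : ℝ) + 1) ≠ x j + ε * ((j : ℝ) + 1) := by
      rw [eventually_all]
      intro i
      rw [eventually_all]
      intro j
      by_cases hij : i = j
      · simp [hij]
      · exact (hne i j hij).mono fun _ h _ => h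
    filter_upwards [hall, self_mem_nhdsWithin] with ε h hε
    refine ⟨fun i j e => by_contra fun hij => h i j hij e, fun i => ?_⟩
    have : 0 < ε * ((i : ℝ) + 1) := mul_pos hε (by positivity)
    linarith [hx i]
  exact (tendsto_nhdsWithin_iff.2 ⟨ht, hg⟩).neBot

lemma tendsto_genericF (hn : 0 < n) (x : Fin n → ℝ) :
    Tendsto genericF (𝓝[genericVectors n] x)
      (𝓝 (gaussMulLog * ∑ i, x i - meanMulLog x)) := by
  have hc : Continuous fun y : Fin n → ℝ => gaussMulLog * ∑ i, y i - meanMulLog y :=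
    (by fun_prop : Continuous fun y : Fin n → ℝ => gaussMulLog * ∑ i, y i).sub continuous_meanMulLog
  refine ((hc.tendsto x).mono_left nhdsWithin_le_nhds).congr' ?_
  filter_upwards [self_mem_nhdsWithin] with y hy
  rw [meanMulLog_eq hn hy]
  ring

lemma F_eq (hn : 0 < n) {x : Fin n → ℝ} (hx : ∀ i, 0 ≤ x i) :
    F x = gaussMulLog * ∑ i, x i - meanMulLog x := by
  rw [F]
  split_ifs with h
  · rw [meanMulLog_eq hn h]
    ring
  · have := nhdsWithin_genericVectors_neBot hx
    exact (tendsto_genericF hn x).limUnder_eq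

/-! ### Superadditivity and the entropy bound. -/

/-- Each `log (a i)` with `a i > 0` is at most the logarithm of the total. -/
lemma sum_mul_log_le {ι : Type*} (s : Finset ι) {a : ι → ℝ} (ha : ∀ i ∈ s, 0 ≤ a i) :
    ∑ i ∈ s, a i * Real.log (a i) ≤ (∑ i ∈ s, a i) * Real.log (∑ i ∈ s, a i) := by
  rw [Finset.sum_mul]
  refine Finset.sum_le_sum fun i hi => ?_
  rcases (ha i hi).eq_or_lt with h | h
  · simp [← h]
  · exact mul_le_mul_of_nonneg_left
      (Real.log_le_log h (Finset.single_le_sum ha hi)) h.le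

lemma le_meanMulLog {x : Fin n → ℝ} (hx : ∀ i, 0 ≤ x i) :
    ∑ i, x i * Real.log (x i) + gaussMulLog * ∑ i, x i ≤ meanMulLog x := by
  have hint : ∀ i, Integrable
      (fun z : Fin n → ℂ => x i * ‖z i‖ ^ 2 * Real.log (x i * ‖z i‖ ^ 2)) (gauss n) := fun i => by
    simpa only [weightedSq_single] using integrable_mul_log_weightedSq (Pi.single i (x i))
  calc ∑ i, x i * Real.log (x i) + gaussMulLog * ∑ i, x i
      = ∫ z : Fin n → ℂ, ∑ i, x i * ‖z i‖ ^ 2 * Real.log (x i * ‖z i‖ ^ 2) ∂(gauss n) := by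
        rw [integral_finsetSum _ fun i _ => hint i]
        simp_rw [integral_mul_log_mul_norm_sq]
        rw [Finset.sum_add_distrib, Finset.mul_sum]
        simp_rw [mul_comm]
    _ ≤ meanMulLog x :=
        integral_mono (integrable_finsetSum _ fun i _ => hint i) (integrable_mul_log_weightedSq x)
          fun z => sum_mul_log_le _ fun i _ => mul_nonneg (hx i) (sq_nonneg _)

/-! ### Quadratic forms and unitary invariance of the Gaussian. -/

/-- The real part of the quadratic form `⟨z|A|z⟩`. -/
noncomputable def quadForm (A : Matrix (Fin n) (Fin n) ℂ) (z : Fin n → ℂ) : ℝ :=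
  (star z ⬝ᵥ (A *ᵥ z)).re

lemma continuous_quadForm (A : Matrix (Fin n) (Fin n) ℂ) : Continuous (quadForm A) := by
  unfold quadForm; fun_prop

lemma quadForm_mulVec (A U : Matrix (Fin n) (Fin n) ℂ) (z : Fin n → ℂ) :
    quadForm A (U *ᵥ z) = quadForm (star U * A * U) z := by
  rw [quadForm, quadForm, star_mulVec, ← dotProduct_mulVec, mulVec_mulVec, mulVec_mulVec,
    star_eq_conjTranspose, mul_assoc]

lemma quadForm_diagonal (x : Fin n → ℝ) (z : Fin n → ℂ) :
    quadForm (diagonal fun i => (x i : ℂ)) z = weightedSq x z := by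
  simp only [quadForm, weightedSq, dotProduct, mulVec_diagonal, Complex.re_sum, Pi.star_apply]
  refine Finset.sum_congr rfl fun i _ => ?_
  rw [mul_left_comm, ← starRingEnd_apply, mul_comm (starRingEnd ℂ _), Complex.mul_conj,
    Complex.normSq_eq_norm_sq, ← Complex.ofReal_mul, Complex.ofReal_re]

lemma quadForm_one (z : Fin n → ℂ) : quadForm 1 z = ∑ i, ‖z i‖ ^ 2 := by
  have := quadForm_diagonal (fun _ => 1) z
  simpa [weightedSq] using this

lemma quadForm_smul (A : Matrix (Fin n) (Fin n) ℂ) (r : ℝ) (z : Fin n → ℂ) :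
    quadForm A ((r : ℂ) • z) = r ^ 2 * quadForm A z := by
  simp only [quadForm, mulVec_smul, star_smul, smul_dotProduct, dotProduct_smul, smul_eq_mul]
  rw [← mul_assoc]
  have : (r : ℂ) * star (r : ℂ) = ((r ^ 2 : ℝ) : ℂ) := by
    simp [sq]
  rw [this, Complex.re_ofReal_mul]

lemma sum_norm_sq_mulVec (U : unitaryGroup (Fin n) ℂ) (z : Fin n → ℂ) :
    ∑ i, ‖(U.1 *ᵥ z) i‖ ^ 2 = ∑ i, ‖z i‖ ^ 2 := by
  rw [← quadForm_one, ← quadForm_one, quadForm_mulVec, mul_one, mem_unitaryGroup_iff'.1 U.2]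

lemma abs_quadForm_le (A : Matrix (Fin n) (Fin n) ℂ) (z : Fin n → ℂ) :
    |quadForm A z| ≤ (∑ i, ∑ j, ‖A i j‖) * ∑ i, ‖z i‖ ^ 2 := by
  have hz : ∀ i j, ‖z i‖ * ‖z j‖ ≤ ∑ l, ‖z l‖ ^ 2 := fun i j => by
    have h : ∀ i, ‖z i‖ ^ 2 ≤ ∑ l, ‖z l‖ ^ 2 := fun i =>
      Finset.single_le_sum (f := fun l => ‖z l‖ ^ 2) (fun l _ => sq_nonneg _) (Finset.mem_univ i)
    nlinarith [h i, h j, two_mul_le_add_sq ‖z i‖ ‖z j‖]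
  generalize ∑ l, ‖z l‖ ^ 2 = N at hz ⊢
  refine (Complex.abs_re_le_norm _).trans ?_
  simp only [dotProduct, mulVec, Finset.mul_sum, Finset.sum_mul]
  refine (norm_sum_le _ _).trans (Finset.sum_le_sum fun i _ => ?_)
  refine (norm_sum_le _ _).trans (Finset.sum_le_sum fun j _ => ?_)
  rw [norm_mul, norm_mul, Pi.star_apply, norm_star, mul_left_comm]
  exact mul_le_mul_of_nonneg_left (hz i j) (norm_nonneg _)

lemma measurePreserving_mulVec (U : unitaryGroup (Fin n) ℂ) :
    MeasurePreserving (fun z : Fin n → ℂ => U.1 *ᵥ z) volume volume := by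
  -- The real determinant of a complex-linear map is the squared modulus of its complex determinant.
  have hdet : |LinearMap.det ((mulVecLin U.1).restrictScalars ℝ)| = 1 := by
    rw [LinearMap.det_restrictScalars, ← toLin'_apply', LinearMap.det_toLin',
      Algebra.norm_complex_apply, Complex.normSq_eq_norm_sq]
    have := det_of_mem_unitary U.2
    rw [CStarRing.norm_of_mem_unitary this]
    simp
  refine ⟨(by fun_prop : Continuous _).measurable, ?_⟩
  have h := Measure.map_linearMap_addHaar_eq_smul_addHaar (volume : Measure (Fin n → ℂ))
    (f := (mulVecLin U.1).restrictScalars ℝ) (fun h0 => by simp [h0] at hdet)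
  rw [abs_inv, hdet, inv_one, ENNReal.ofReal_one, one_smul] at h
  exact h

lemma mulVec_injective (U : unitaryGroup (Fin n) ℂ) :
    Function.Injective fun z : Fin n → ℂ => U.1 *ᵥ z := by
  intro z w h
  have := congrArg (fun v => star U.1 *ᵥ v) h
  simpa [mulVec_mulVec, mem_unitaryGroup_iff'.1 U.2] using this

lemma integral_gauss_mulVec {E : Type*} [NormedAddCommGroup E] [NormedSpace ℝ E]
    (U : unitaryGroup (Fin n) ℂ) (f : (Fin n → ℂ) → E) :
    ∫ z, f (U.1 *ᵥ z) ∂(gauss n) = ∫ z, f z ∂(gauss n) := by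
  have hU : Continuous fun z : Fin n → ℂ => U.1 *ᵥ z := by fun_prop
  rw [integral_gauss, integral_gauss, ← (measurePreserving_mulVec U).integral_comp
    (hU.measurableEmbedding (mulVec_injective U)) fun z => (∏ i, gaussDensity (z i)) • f z]
  simp_rw [prod_gaussDensity, sum_norm_sq_mulVec]

/-- Rotating `z` by the eigenvector unitary diagonalises the form, so only the eigenvalues matter.
-/
lemma integral_comp_quadForm {A : Matrix (Fin n) (Fin n) ℂ} (hA : A.IsHermitian) (k : ℝ → ℝ) :
    ∫ z, k (quadForm A z) ∂(gauss n) = ∫ z, k (weightedSq hA.eigenvalues z) ∂(gauss n) := by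
  rw [← integral_gauss_mulVec hA.eigenvectorUnitary]
  have := hA.conjStarAlgAut_star_eigenvectorUnitary
  rw [Unitary.conjStarAlgAut_star_apply] at this
  simp_rw [quadForm_mulVec, this]
  simp_rw [← quadForm_diagonal]
  rfl

lemma exists_unitary_col_eq (φ : EuclideanSpace ℂ (Fin n)) (hφ : ‖φ‖ = 1) (i : Fin n) :
    ∃ V : unitaryGroup (Fin n) ℂ, V.1 *ᵥ Pi.single i 1 = φ.ofLp := by
  have ho : Orthonormal ℂ (({i} : Set (Fin n)).domRestrict fun _ : Fin n => φ) := by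
    refine ⟨fun _ => hφ, fun a b hab => absurd (Subsingleton.elim a b) hab⟩
  obtain ⟨b, hb⟩ := ho.exists_orthonormalBasis_extension_of_card_eq (by simp)
  refine ⟨⟨(EuclideanSpace.basisFun (Fin n) ℂ).toBasis.toMatrix b.toBasis,
    (EuclideanSpace.basisFun (Fin n) ℂ).toMatrix_orthonormalBasis_mem_unitary b⟩, ?_⟩
  ext k
  rw [mulVec_single_one]
  simp [Matrix.col_apply, Module.Basis.toMatrix_apply, hb i rfl]

/-! ### From Gaussian means to Haar means. -/

instance : (haarUnitary n).IsHaarMeasure :=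
  inferInstanceAs (Measure.haarMeasure _).IsHaarMeasure

instance : (haarUnitary n).IsMulRightInvariant where
  map_mul_right_eq_self g := by
    -- A right translate is again a Haar probability measure, and that is unique.
    have : IsProbabilityMeasure ((haarUnitary n).map (· * g)) :=
      Measure.isProbabilityMeasure_map (by fun_prop)
    exact Measure.isHaarMeasure_eq_of_isProbabilityMeasure _ _

lemma integrable_haar {f : unitaryGroup (Fin n) ℂ → ℝ} (hf : Continuous f) :
    Integrable f (haarUnitary n) :=
  hf.integrable_of_hasCompactSupport (HasCompactSupport.of_compactSpace f)

lemma continuous_col (i : Fin n) :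
    Continuous fun U : unitaryGroup (Fin n) ℂ => U.1.col i :=
  continuous_pi fun k => (continuous_apply_apply k i).comp continuous_subtype_val

/-- Writing `z = ‖z‖ V e_i` with `V` unitary, right invariance absorbs `V`; only the norm of `z` is
left. -/
lemma integral_haar_comp_quadForm_mulVec (A : Matrix (Fin n) (Fin n) ℂ) (k : ℝ → ℝ) (i : Fin n)
    (z : Fin n → ℂ) :
    ∫ U, k (quadForm A (U.1 *ᵥ z)) ∂(haarUnitary n) =
      ∫ U, k ((∑ j, ‖z j‖ ^ 2) * quadForm A (U.1.col i)) ∂(haarUnitary n) := by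
  by_cases hz : z = 0
  · simp [hz, quadForm]
  set φ : EuclideanSpace ℂ (Fin n) := WithLp.toLp 2 z with hφ
  have hφ0 : ‖φ‖ ≠ 0 := norm_ne_zero_iff.2 fun h => hz (by simpa [hφ] using h)
  obtain ⟨V, hV⟩ := exists_unitary_col_eq ((‖φ‖⁻¹ : ℂ) • φ) (by
    rw [norm_smul]; simp [hφ0]) i
  have hz' : z = (‖φ‖ : ℂ) • (V.1 *ᵥ Pi.single i 1) := by
    rw [hV]
    have : (‖φ‖ : ℂ) ≠ 0 := Complex.ofReal_ne_zero.2 hφ0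
    rw [WithLp.ofLp_smul, smul_smul, mul_inv_cancel₀ this, one_smul]
  have hn : ‖φ‖ ^ 2 = ∑ j, ‖z j‖ ^ 2 := by
    rw [EuclideanSpace.norm_sq_eq]
  rw [← integral_mul_right_eq_self
    (fun U : unitaryGroup (Fin n) ℂ => k ((∑ j, ‖z j‖ ^ 2) * quadForm A (U.1.col i))) V]
  congr 1 with U
  rw [← hn, ← mulVec_single_one]
  conv_lhs => rw [hz', mulVec_smul, quadForm_smul, mulVec_mulVec]
  rfl

/-- Averaging the unitarily invariant Gaussian integral over `U` changes nothing; Fubini then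
separates norm and direction. -/
lemma integral_comp_quadForm_eq_haar (A : Matrix (Fin n) (Fin n) ℂ) {k : ℝ → ℝ}
    (hk : Continuous k) (hk' : ∀ t, |k t| ≤ 1 + t ^ 2) (i : Fin n) :
    ∫ z, k (quadForm A z) ∂(gauss n) =
      ∫ z : Fin n → ℂ, ∫ U, k ((∑ j, ‖z j‖ ^ 2) * quadForm A (U.1.col i)) ∂(haarUnitary n)
        ∂(gauss n) := by
  have : SecondCountableTopology (Matrix (Fin n) (Fin n) ℂ) :=
    inferInstanceAs (SecondCountableTopology (Fin n → Fin n → ℂ))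
  have hcont : Continuous fun p : unitaryGroup (Fin n) ℂ × (Fin n → ℂ) =>
      k (quadForm A (p.1.1 *ᵥ p.2)) :=
    hk.comp ((continuous_quadForm A).comp (by fun_prop))
  have hint : Integrable (Function.uncurry fun (U : unitaryGroup (Fin n) ℂ) (z : Fin n → ℂ) =>
      k (quadForm A (U.1 *ᵥ z))) ((haarUnitary n).prod (gauss n)) := by
    refine ((integrable_growth_bound (∑ i, ∑ j, ‖A i j‖)).comp_snd (haarUnitary n)).mono'
      hcont.aestronglyMeasurable (.of_forall fun p => norm_comp_le_of_growth hk' ?_)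
    rw [← sum_norm_sq_mulVec p.1]
    exact abs_quadForm_le A _
  calc ∫ z, k (quadForm A z) ∂(gauss n)
      = ∫ U : unitaryGroup (Fin n) ℂ, ∫ z, k (quadForm A (U.1 *ᵥ z)) ∂(gauss n)
          ∂(haarUnitary n) := by
        simp_rw [fun U : unitaryGroup (Fin n) ℂ =>
          integral_gauss_mulVec U fun z => k (quadForm A z)]
        simp
    _ = _ := by
        rw [integral_integral_swap hint]
        simp_rw [integral_haar_comp_quadForm_mulVec A k i]

lemma continuous_quadForm_col (A : Matrix (Fin n) (Fin n) ℂ) (i : Fin n) :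
    Continuous fun U : unitaryGroup (Fin n) ℂ => quadForm A (U.1.col i) :=
  (continuous_quadForm A).comp (continuous_col i)

lemma integral_sum_norm_sq : ∫ z : Fin n → ℂ, ∑ j, ‖z j‖ ^ 2 ∂(gauss n) = n := by
  simpa [weightedSq] using integral_weightedSq (n := n) fun _ => 1

lemma integral_quadForm_eq_haar (A : Matrix (Fin n) (Fin n) ℂ) (i : Fin n) :
    ∫ z, quadForm A z ∂(gauss n) = n * ∫ U, quadForm A (U.1.col i) ∂(haarUnitary n) := by
  have h := integral_comp_quadForm_eq_haar A continuous_id abs_le_one_add_sq i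
  simp only [id, integral_const_mul, integral_mul_const, integral_sum_norm_sq] at h
  exact h

lemma integral_mul_log_quadForm_eq_haar (A : Matrix (Fin n) (Fin n) ℂ) (i : Fin n) :
    ∫ z, quadForm A z * Real.log (quadForm A z) ∂(gauss n) =
      n * ∫ U, quadForm A (U.1.col i) * Real.log (quadForm A (U.1.col i)) ∂(haarUnitary n) +
      meanMulLog (fun _ : Fin n => 1) * ∫ U, quadForm A (U.1.col i) ∂(haarUnitary n) := by
  have h := integral_comp_quadForm_eq_haar A Real.continuous_mul_log abs_mul_log_le i
  have h1 : ∀ z : Fin n → ℂ, weightedSq (fun _ : Fin n => 1) z = ∑ j, ‖z j‖ ^ 2 :=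
    fun z => by simp [weightedSq]
  have i1 := integrable_weightedSq fun _ : Fin n => (1 : ℝ)
  have i2 := integrable_mul_log_weightedSq fun _ : Fin n => (1 : ℝ)
  have c1 := continuous_quadForm_col A i
  have c2 : Continuous fun U : unitaryGroup (Fin n) ℂ =>
      quadForm A (U.1.col i) * Real.log (quadForm A (U.1.col i)) :=
    Real.continuous_mul_log.comp c1
  simp only [meanMulLog, h1, funext h1] at i1 i2 ⊢
  have e : ∀ z : Fin n → ℂ, ∫ U : unitaryGroup (Fin n) ℂ,
      (∑ j, ‖z j‖ ^ 2) * quadForm A (U.1.col i) *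
        Real.log ((∑ j, ‖z j‖ ^ 2) * quadForm A (U.1.col i)) ∂(haarUnitary n) =
      (∑ j, ‖z j‖ ^ 2) * Real.log (∑ j, ‖z j‖ ^ 2) *
          ∫ U, quadForm A (U.1.col i) ∂(haarUnitary n) +
        (∑ j, ‖z j‖ ^ 2) * ∫ U, quadForm A (U.1.col i) *
          Real.log (quadForm A (U.1.col i)) ∂(haarUnitary n) := fun z => by
    simp_rw [mul_log_mul]
    rw [integral_add ((integrable_haar c1).const_mul _) ((integrable_haar c2).const_mul _),
      integral_const_mul, integral_const_mul]
  rw [h]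
  simp_rw [e]
  rw [integral_add (i2.mul_const _) (i1.mul_const _), integral_mul_const, integral_mul_const,
    integral_sum_norm_sq, add_comm]

/-- The Haar average of `⟨e_i|A|e_i⟩ ln ⟨e_i|A|e_i⟩` does not depend on the basis vector. -/
lemma integral_haar_mul_log (A : Matrix (Fin n) (Fin n) ℂ) (i : Fin n)
    (hA : ∫ z, quadForm A z ∂(gauss n) = 1) :
    ∫ U, quadForm A (U.1.col i) * Real.log (quadForm A (U.1.col i)) ∂(haarUnitary n) =
      (∫ z, quadForm A z * Real.log (quadForm A z) ∂(gauss n) -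
        meanMulLog (fun _ : Fin n => 1) / n) / n := by
  have hn : (n : ℝ) ≠ 0 := Nat.cast_ne_zero.2 i.pos.ne'
  have h1 := integral_quadForm_eq_haar A i
  rw [hA] at h1
  have h2 : ∫ U, quadForm A (U.1.col i) ∂(haarUnitary n) = (n : ℝ)⁻¹ := by
    field_simp
    linarith
  rw [integral_mul_log_quadForm_eq_haar A i, h2]
  field_simp
  ring

/-- Rotating `z` by a unitary `V` with `V e_i = φ` turns `⟨φ|z⟩` into `z i`. -/
lemma integral_comp_quadForm_ketbra (φ : EuclideanSpace ℂ (Fin n)) (hφ : ‖φ‖ = 1) (i : Fin n)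
    (k : ℝ → ℝ) :
    ∫ z, k (quadForm (ketbra φ.ofLp) z) ∂(gauss n) = ∫ z, k (‖z i‖ ^ 2) ∂(gauss n) := by
  obtain ⟨V, hV⟩ := exists_unitary_col_eq φ hφ i
  rw [← integral_gauss_mulVec V]
  congr 1 with z
  congr 1
  have h : star φ.ofLp ⬝ᵥ (V.1 *ᵥ z) = z i := by
    rw [← hV, star_mulVec, ← dotProduct_mulVec, mulVec_mulVec, ← star_eq_conjTranspose,
      mem_unitaryGroup_iff'.1 V.2, one_mulVec]
    simp
  have h' : star (V.1 *ᵥ z) ⬝ᵥ φ.ofLp = star (z i) := by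
    rw [← h, star_dotProduct]
  rw [quadForm, ketbra, vecMulVec_mulVec, h]
  simp [dotProduct_smul, h', Complex.mul_conj, Complex.normSq_eq_norm_sq]
  rw [← Complex.ofReal_pow, Complex.ofReal_re]

/-! ### Functional calculus and the measured states. -/

lemma isHermitian_diagonal_ofReal (x : Fin n → ℝ) :
    (diagonal fun i => (x i : ℂ)).IsHermitian :=
  isHermitian_diagonal_of_self_adjoint _ (by ext i; simp)

lemma aeval_conj_diagonal (U : unitaryGroup (Fin n) ℂ) (x : Fin n → ℝ) (p : Polynomial ℝ) :
    Polynomial.aeval (U.1 * (diagonal fun i => (x i : ℂ)) * star U.1) p =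
      U.1 * (diagonal fun i => ((p.eval (x i) : ℝ) : ℂ)) * star U.1 := by
  have hU := mem_unitaryGroup_iff.1 U.2
  have hU' := mem_unitaryGroup_iff'.1 U.2
  induction p using Polynomial.induction_on' with
  | add p q hp hq =>
    rw [map_add, hp, hq, ← add_mul, ← mul_add, diagonal_add]
    simp
  | monomial k a =>
    have hpow : (U.1 * (diagonal fun i => (x i : ℂ)) * star U.1) ^ k =
        U.1 * (diagonal fun i => (x i : ℂ)) ^ k * star U.1 := by
      induction k with
      | zero => simp [hU]
      | succ k ih =>
        rw [pow_succ, ih, pow_succ]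
        simp only [mul_assoc]
        rw [← mul_assoc (star U.1) U.1, hU', one_mul]
    rw [Polynomial.aeval_monomial, hpow, diagonal_pow, Algebra.algebraMap_eq_smul_one,
      smul_mul_assoc, one_mul, ← smul_mul_assoc, ← mul_smul_comm, ← diagonal_smul]
    congr 3
    ext i
    simp

lemma cfc_conj_diagonal (U : unitaryGroup (Fin n) ℂ) (x : Fin n → ℝ) (f : ℝ → ℝ) :
    cfc f (U.1 * (diagonal fun i => (x i : ℂ)) * star U.1) =
      U.1 * (diagonal fun i => (f (x i) : ℂ)) * star U.1 := by
  classical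
  set A := U.1 * (diagonal fun i => (x i : ℂ)) * star U.1 with hA
  have hH : A.IsHermitian := isHermitian_mul_mul_conjTranspose _ (isHermitian_diagonal_ofReal x)
  have hfin := Matrix.finite_real_spectrum (A := A)
  -- On finitely many points any `f` is a polynomial. The nodes include both the spectrum and the
  -- entries `x i`, so the two need not be compared.
  let s : Finset ℝ := hfin.toFinset ∪ Finset.univ.image x
  let p := Lagrange.interpolate s id f
  have hp : ∀ t ∈ s, p.eval t = f t := fun t ht =>
    Lagrange.eval_interpolate_at_node (v := id) f (Set.injOn_id _) ht
  have h1 : cfc f A = cfc p.eval A :=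
    cfc_congr fun t ht => (hp t (Finset.mem_union_left _ (hfin.mem_toFinset.2 ht))).symm
  rw [h1, cfc_polynomial p A hH.isSelfAdjoint, hA, aeval_conj_diagonal]
  simp_rw [fun i => hp (x i) (Finset.mem_union_right _ (Finset.mem_image_of_mem x (Finset.mem_univ i)))]

lemma conj_diagonal_mul (U : unitaryGroup (Fin n) ℂ) (d e : Fin n → ℂ) :
    (U.1 * diagonal d * star U.1) * (U.1 * diagonal e * star U.1) =
      U.1 * (diagonal fun i => d i * e i) * star U.1 := by
  rw [← diagonal_mul_diagonal]
  simp only [mul_assoc]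
  rw [← mul_assoc (star U.1) U.1, mem_unitaryGroup_iff'.1 U.2, one_mul]

lemma trace_conj_diagonal (U : unitaryGroup (Fin n) ℂ) (d : Fin n → ℂ) :
    (U.1 * diagonal d * star U.1).trace = ∑ i, d i := by
  rw [trace_mul_comm, ← mul_assoc, mem_unitaryGroup_iff'.1 U.2, one_mul, trace_diagonal]

lemma measure_eq {A : Matrix (Fin n) (Fin n) ℂ} (hA : A.IsHermitian)
    (U : unitaryGroup (Fin n) ℂ) :
    measure U A = U.1 * (diagonal fun i => (quadForm A (U.1.col i) : ℂ)) * star U.1 := by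
  have h : ∀ i, star (U.1.col i) ⬝ᵥ (A *ᵥ U.1.col i) = (quadForm A (U.1.col i) : ℂ) := by
    intro i
    refine (Complex.conj_eq_iff_re.1 ?_).symm
    rw [starRingEnd_apply, ← star_dotProduct, star_mulVec, hA.eq, dotProduct_mulVec]
  ext k l
  simp only [measure, h, ketbra, Matrix.sum_apply, Matrix.smul_apply, vecMulVec_apply, smul_eq_mul]
  rw [mul_apply]
  simp only [mul_diagonal, star_apply, col_apply, Pi.star_apply]
  exact Finset.sum_congr rfl fun i _ => by ring

lemma quadForm_nonneg {A : Matrix (Fin n) (Fin n) ℂ} (hA : A.PosSemidef) (z : Fin n → ℂ) :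
    0 ≤ quadForm A z :=
  (Complex.le_def.1 (hA.dotProduct_mulVec_nonneg z)).1

lemma vonNeumannEntropy_eq (ρ : State n) :
    vonNeumannEntropy ρ = -∑ i, ρ.eigenvalues i * Real.log (ρ.eigenvalues i) := by
  have hs := ρ.posSemidef.isHermitian.spectral_theorem
  rw [Unitary.conjStarAlgAut_apply] at hs
  have hs' : ρ.mat = (ρ.posSemidef.isHermitian.eigenvectorUnitary).1 *
    (diagonal fun i => (ρ.eigenvalues i : ℂ)) *
      star (ρ.posSemidef.isHermitian.eigenvectorUnitary).1 := hs
  rw [vonNeumannEntropy]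
  nth_rw 2 [hs']
  rw [cfc_conj_diagonal]
  nth_rw 1 [hs']
  rw [conj_diagonal_mul, trace_conj_diagonal]
  simp [← Complex.ofReal_mul]

lemma relEntropy_measure {A B : Matrix (Fin n) (Fin n) ℂ} (hA : A.IsHermitian)
    (hB : B.IsHermitian) (U : unitaryGroup (Fin n) ℂ)
    (h : ∀ i, quadForm B (U.1.col i) = 0 → quadForm A (U.1.col i) = 0) :
    relEntropy (measure U A) (measure U B) =
      ((∑ i, (quadForm A (U.1.col i) * Real.log (quadForm A (U.1.col i)) -
        quadForm A (U.1.col i) * Real.log (quadForm B (U.1.col i))) : ℝ) : EReal) := by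
  rw [measure_eq hA, measure_eq hB, relEntropy, if_pos]
  · rw [cfc_conj_diagonal, cfc_conj_diagonal, conj_diagonal_mul, conj_diagonal_mul, trace_sub,
      trace_conj_diagonal, trace_conj_diagonal, ← Finset.sum_sub_distrib]
    simp [← Complex.ofReal_mul]
  · have : U.1 * (diagonal fun i => (quadForm A (U.1.col i) : ℂ)) * star U.1 =
        (U.1 * (diagonal fun i => (quadForm B (U.1.col i) : ℂ)) * star U.1) *
        (U.1 * (diagonal fun i => (quadForm A (U.1.col i) : ℂ) / quadForm B (U.1.col i)) *
          star U.1) := by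
      rw [conj_diagonal_mul]
      congr 3
      ext i
      by_cases hi : quadForm B (U.1.col i) = 0
      · simp [hi, h i hi]
      · rw [mul_div_cancel₀]
        exact_mod_cast hi
    rw [this, mulVecLin_mul]
    exact LinearMap.range_comp_le_range _ _

lemma haarAverage_coe {f : unitaryGroup (Fin n) ℂ → ℝ} (hf : Integrable f (haarUnitary n)) :
    haarAverage (fun U => (f U : EReal)) = ((∫ U, f U ∂(haarUnitary n) : ℝ) : EReal) := by
  have h1 : ∀ g : unitaryGroup (Fin n) ℂ → ℝ, Integrable g (haarUnitary n) →
      ((∫⁻ U, ENNReal.ofReal (g U) ∂(haarUnitary n) : ℝ≥0∞) : EReal) =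
        (((∫⁻ U, ENNReal.ofReal (g U) ∂(haarUnitary n)).toReal : ℝ) : EReal) := by
    intro g hg
    rw [EReal.coe_ennreal_toReal]
    exact (lintegral_ofReal_le_lintegral_enorm g).trans_lt hg.2 |>.ne
  rw [haarAverage, integral_eq_lintegral_pos_part_sub_lintegral_neg_part hf, EReal.coe_sub,
    ← h1 _ hf, ← h1 (fun U => -f U) hf.neg]
  simp_rw [← EReal.coe_neg, EReal.real_coe_toENNReal]

/-! ### Assembly for states. -/

lemma State.pos (ρ : State n) : 0 < n := by
  rcases Nat.eq_zero_or_pos n with rfl | h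
  · have := ρ.trace_eq_one
    simp [Matrix.trace] at this
  · exact h

lemma State.eigenvalues_nonneg (ρ : State n) (i : Fin n) : 0 ≤ ρ.eigenvalues i :=
  ρ.posSemidef.eigenvalues_nonneg i

lemma State.sum_eigenvalues (ρ : State n) : ∑ i, ρ.eigenvalues i = 1 := by
  have h := ρ.posSemidef.isHermitian.trace_eq_sum_eigenvalues
  rw [ρ.trace_eq_one] at h
  have h' : ((∑ i, ρ.eigenvalues i : ℝ) : ℂ) = 1 := by
    rw [h]
    push_cast
    rfl
  exact_mod_cast h'

lemma subentropy_eq (ρ : State n) :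
    subentropy ρ = gaussMulLog - meanMulLog ρ.eigenvalues := by
  rw [subentropy, F_eq ρ.pos ρ.eigenvalues_nonneg, ρ.sum_eigenvalues, mul_one]

lemma tendsto_genericF_subentropy (ρ : State n) :
    Tendsto genericF (𝓝[genericVectors n] ρ.eigenvalues) (𝓝 (subentropy ρ)) := by
  rw [subentropy, F_eq ρ.pos ρ.eigenvalues_nonneg]
  exact tendsto_genericF ρ.pos _

lemma subentropy_le (ρ : State n) : subentropy ρ ≤ vonNeumannEntropy ρ := by
  have h := le_meanMulLog ρ.eigenvalues_nonneg
  rw [ρ.sum_eigenvalues] at h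
  rw [subentropy_eq, vonNeumannEntropy_eq]
  linarith

lemma State.integral_haar_mul_log (ρ : State n) (i : Fin n) :
    ∫ U, quadForm ρ.mat (U.1.col i) * Real.log (quadForm ρ.mat (U.1.col i)) ∂(haarUnitary n) =
      (meanMulLog ρ.eigenvalues - meanMulLog (fun _ : Fin n => 1) / n) / n := by
  have hH := ρ.posSemidef.isHermitian
  rw [Subentropy.integral_haar_mul_log, integral_comp_quadForm hH fun t => t * Real.log t]
  · rfl
  · rw [integral_comp_quadForm hH fun t => t]
    exact (integral_weightedSq _).trans ρ.sum_eigenvalues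

lemma integral_haar_mul_log_ketbra (φ : EuclideanSpace ℂ (Fin n)) (hφ : ‖φ‖ = 1) (i : Fin n) :
    ∫ U, quadForm (ketbra φ.ofLp) (U.1.col i) * Real.log (quadForm (ketbra φ.ofLp) (U.1.col i))
        ∂(haarUnitary n) =
      (gaussMulLog - meanMulLog (fun _ : Fin n => 1) / n) / n := by
  rw [Subentropy.integral_haar_mul_log,
    integral_comp_quadForm_ketbra φ hφ i fun t => t * Real.log t, integral_mul_log_norm_sq]
  rw [integral_comp_quadForm_ketbra φ hφ i fun t => t, integral_norm_sq]

lemma posSemidef_ketbra (v : Fin n → ℂ) : (ketbra v).PosSemidef :=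
  posSemidef_vecMulVec_self_star v

lemma quadForm_sum {m : ℕ} (p : Fin m → ℝ) (A : Fin m → Matrix (Fin n) (Fin n) ℂ)
    (z : Fin n → ℂ) :
    quadForm (∑ j, (p j : ℂ) • A j) z = ∑ j, p j * quadForm (A j) z := by
  simp [quadForm, Matrix.sum_mulVec, dotProduct_sum, smul_mulVec, dotProduct_smul]

lemma continuous_quadForm_col_mul_log (A : Matrix (Fin n) (Fin n) ℂ) (i : Fin n) :
    Continuous fun U : unitaryGroup (Fin n) ℂ =>
      quadForm A (U.1.col i) * Real.log (quadForm A (U.1.col i)) :=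
  Real.continuous_mul_log.comp (continuous_quadForm_col A i)

/-- The factor `log ⟨e_i|B|e_i⟩` may be unbounded, but `p A ≤ B` as forms dominates the product by
the continuous `b ln b`, `b = ⟨e_i|B|e_i⟩`. -/
lemma integrable_quadForm_col_mul_log {A B : Matrix (Fin n) (Fin n) ℂ} {p : ℝ}
    (hA : A.PosSemidef) (h : ∀ z, p * quadForm A z ≤ quadForm B z) (hp : 0 ≤ p) (i : Fin n) :
    Integrable (fun U : unitaryGroup (Fin n) ℂ =>
      p * quadForm A (U.1.col i) * Real.log (quadForm B (U.1.col i))) (haarUnitary n) := by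
  refine (integrable_haar (continuous_quadForm_col_mul_log B i)).mono ?_ (.of_forall fun U => ?_)
  · exact (((continuous_quadForm_col A i).measurable.const_mul p).mul
      (Real.measurable_log.comp (continuous_quadForm_col B i).measurable)).aestronglyMeasurable
  · have h0 := mul_nonneg hp (quadForm_nonneg hA (U.1.col i))
    rw [norm_mul, norm_mul _ (Real.log _)]
    refine mul_le_mul_of_nonneg_right ?_ (norm_nonneg _)
    rw [Real.norm_of_nonneg h0, Real.norm_of_nonneg (h0.trans (h _))]
    exact h _

lemma coe_sum_ereal {ι : Type*} (s : Finset ι) (f : ι → ℝ) :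
    ((∑ i ∈ s, f i : ℝ) : EReal) = ∑ i ∈ s, (f i : EReal) :=
  map_sum (⟨⟨Real.toEReal, EReal.coe_zero⟩, EReal.coe_add⟩ : ℝ →+ EReal) f s

lemma mul_haarAverage_relEntropy {A B : Matrix (Fin n) (Fin n) ℂ} {p : ℝ}
    (hA : A.PosSemidef) (hB : B.PosSemidef) (h : ∀ z, p * quadForm A z ≤ quadForm B z)
    (hp : 0 ≤ p) :
    (p : EReal) * haarAverage (fun U => relEntropy (measure U A) (measure U B)) =
      ((∑ i, (p * ∫ U, quadForm A (U.1.col i) * Real.log (quadForm A (U.1.col i))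
          ∂(haarUnitary n) -
        ∫ U, p * quadForm A (U.1.col i) * Real.log (quadForm B (U.1.col i))
          ∂(haarUnitary n)) : ℝ) : EReal) := by
  -- For `p = 0` the hypothesis does not control supports, and the convention `0 * ⊤ = 0` is needed.
  -- For `p > 0` the support condition holds at every `U`.
  rcases hp.eq_or_lt with rfl | hp'
  · simp
  have hsupp : ∀ z, quadForm B z = 0 → quadForm A z = 0 := fun z hz =>
    le_antisymm (nonpos_of_mul_nonpos_right ((h z).trans hz.le) hp') (quadForm_nonneg hA z)
  have i1 := fun i => integrable_haar (continuous_quadForm_col_mul_log A i)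
  have i2 : ∀ i, Integrable (fun U : unitaryGroup (Fin n) ℂ =>
      quadForm A (U.1.col i) * Real.log (quadForm B (U.1.col i))) (haarUnitary n) := fun i => by
    refine ((integrable_quadForm_col_mul_log hA h hp i).const_mul p⁻¹).congr
      (.of_forall fun U => ?_)
    field_simp
  simp_rw [fun U => relEntropy_measure hA.isHermitian hB.isHermitian U fun i => hsupp _]
  have i3 : ∀ i, Integrable (fun U : unitaryGroup (Fin n) ℂ =>
      quadForm A (U.1.col i) * Real.log (quadForm A (U.1.col i)) -
        quadForm A (U.1.col i) * Real.log (quadForm B (U.1.col i))) (haarUnitary n) :=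
    fun i => (i1 i).sub (i2 i)
  rw [haarAverage_coe (integrable_finsetSum _ fun i _ => i3 i), ← EReal.coe_mul,
    integral_finsetSum _ fun i _ => i3 i, Finset.mul_sum]
  congr 1
  refine Finset.sum_congr rfl fun i _ => ?_
  rw [integral_sub (i1 i) (i2 i), mul_sub, ← integral_const_mul p]
  simp_rw [mul_assoc, integral_const_mul]

lemma subentropy_eq_sum_haarAverage (ρ : State n) {m : ℕ} (p : Fin m → ℝ)
    (φ : Fin m → EuclideanSpace ℂ (Fin n)) (hp : ∀ j, 0 ≤ p j) (hp1 : ∑ j, p j = 1)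
    (hφ : ∀ j, ‖φ j‖ = 1) (hρ : ρ.mat = ∑ j, (p j : ℂ) • ketbra (φ j).ofLp) :
    (subentropy ρ : EReal) = ∑ j, (p j : EReal) * haarAverage fun U =>
      relEntropy (measure U (ketbra (φ j).ofLp)) (measure U ρ.mat) := by
  have hq : ∀ z, quadForm ρ.mat z = ∑ j, p j * quadForm (ketbra (φ j).ofLp) z := fun z => by
    rw [hρ, quadForm_sum]
  have hle : ∀ j z, p j * quadForm (ketbra (φ j).ofLp) z ≤ quadForm ρ.mat z := fun j z => by
    rw [hq]
    exact Finset.single_le_sum (f := fun j => p j * quadForm (ketbra (φ j).ofLp) z)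
      (fun j _ => mul_nonneg (hp j) (quadForm_nonneg (posSemidef_ketbra _) z)) (Finset.mem_univ j)
  simp_rw [fun j => mul_haarAverage_relEntropy (posSemidef_ketbra _) ρ.posSemidef (hle j) (hp j)]
  rw [← coe_sum_ereal]
  congr 1
  rw [Finset.sum_comm]
  have key : ∀ i : Fin n, ∑ j, (p j * ∫ U, quadForm (ketbra (φ j).ofLp) (U.1.col i) *
        Real.log (quadForm (ketbra (φ j).ofLp) (U.1.col i)) ∂(haarUnitary n) -
      ∫ U, p j * quadForm (ketbra (φ j).ofLp) (U.1.col i) *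
        Real.log (quadForm ρ.mat (U.1.col i)) ∂(haarUnitary n)) =
      (gaussMulLog - meanMulLog ρ.eigenvalues) / n := fun i => by
    simp_rw [integral_haar_mul_log_ketbra _ (hφ _)]
    rw [Finset.sum_sub_distrib, ← Finset.sum_mul, hp1, ← integral_finsetSum _ fun j _ =>
      integrable_quadForm_col_mul_log (posSemidef_ketbra _) (hle j) (hp j) i]
    -- The cross terms add up to `b ln b` for `ρ` itself, since `∑ p_j ⟨e_i|P_j|e_i⟩ = ⟨e_i|ρ|e_i⟩`;
    -- the common constant then cancels.
    simp_rw [← Finset.sum_mul, ← hq, ρ.integral_haar_mul_log]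
    ring
  simp_rw [key]
  have hn : (n : ℝ) ≠ 0 := Nat.cast_ne_zero.2 ρ.pos.ne'
  rw [subentropy_eq]
  simp
  field_simp

end Subentropy

/-- For every state `ρ`: the limit defining the subentropy at the eigenvalues of `ρ` exists; for
every finite convex decomposition of `ρ` into pure states the subentropy is the mean of the
Haar-averaged relative entropies between the measured states; and `Q(ρ) ≤ S(ρ)`. -/
theorem proposition2p1 (n : ℕ) (ρ : Subentropy.State n) :
    Tendsto Subentropy.genericF (𝓝[Subentropy.genericVectors n] ρ.eigenvalues)
      (𝓝 (Subentropy.subentropy ρ)) ∧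
    (∀ (m : ℕ) (p : Fin m → ℝ) (φ : Fin m → EuclideanSpace ℂ (Fin n)),
      (∀ j, 0 ≤ p j) → ∑ j, p j = 1 → (∀ j, ‖φ j‖ = 1) →
      ρ.mat = ∑ j, (p j : ℂ) • Subentropy.ketbra (φ j).ofLp →
      (Subentropy.subentropy ρ : EReal) =
        ∑ j, (p j : EReal) * Subentropy.haarAverage fun U =>
          Subentropy.relEntropy (Subentropy.measure U (Subentropy.ketbra (φ j).ofLp))
            (Subentropy.measure U ρ.mat)) ∧
    Subentropy.subentropy ρ ≤ Subentropy.vonNeumannEntropy ρ := by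
  exact ⟨Subentropy.tendsto_genericF_subentropy ρ,
    fun _ p φ hp hp1 hφ hρ => Subentropy.subentropy_eq_sum_haarAverage ρ p φ hp hp1 hφ hρ,
    Subentropy.subentropy_le ρ⟩
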